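/- Let $(X,\|\cdot\|)$ be a Banach space, $C\subseteq X$ a closed convex set, and $T:C\to C$ nonexpansive, i.e. $\|Tx-Ty\|\le\|x-y\|$ for all $x,y\in C$. Let $\alpha_n\in[0,1]$ and $e_n\in X$ for $n\ge 1$, and let $(x_n)_{n\ge 0}$ be a sequence in $C$ generated by the inexact Krasnosel'skii–Mann iteration $$x_{n+1}=(1-\alpha_{n+1})\,x_n+\alpha_{n+1}\,(Tx_n+e_{n+1}),\qquad n\ge 0.$$ Suppose that $\|x_n-Tx_n\|\to 0$ and $\sum_{k\ge 1}\alpha_k\|e_k\|<\infty$. Write $\mathrm{Fix}(T)=\{p\in C: Tp=p\}$. (a) If $T(C)$ is relatively compact, then $x_n$ converges strongly to a fixed point of $T$. (b) If $X$ is uniformly convex and $(x_n)$ is bounded, then $\mathrm{Fix}(T)\ne\emptyset$. If, moreover, $X$ has Opial's property, i.e. for every weakly convergent sequence $z_n\rightharpoonup z$ in $X$ one has $$\liminf_{n\to\infty}\|z_n-z\|<\liminf_{n\to\infty}\|z_n-y\|\quad\text{for all } y\ne z,$$ then $x_n$ converges weakly to a fixed point of $T$. -/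

import Mathlib

open Filter Topology

/-- `T` is a nonexpansive self-map of `C`. Only the values of `T` on `C` matter. -/
def IsNonexpansiveOn {X : Type*} [NormedAddCommGroup X] (T : X → X) (C : Set X) : Prop :=
  Set.MapsTo T C C ∧ ∀ x ∈ C, ∀ y ∈ C, ‖T x - T y‖ ≤ ‖x - y‖

/-- The set of fixed points of the map `T` with domain `C`. -/
def fixSet {X : Type*} (T : X → X) (C : Set X) : Set X := {p | p ∈ C ∧ T p = p}

/-- `x` is generated by the inexact Krasnosel'skii-Mann iteration for the map `T` with domain `C`,
with stepsizes `α 1, α 2, …` and errors `e 1, e 2, …` (`α 0` and `e 0` play no role);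
the iterates stay in `C`. -/
structure IsInexactKM {X : Type*} [NormedAddCommGroup X] [NormedSpace ℝ X]
    (T : X → X) (C : Set X) (α : ℕ → ℝ) (e : ℕ → X) (x : ℕ → X) : Prop where
  mem : ∀ n, x n ∈ C
  step : ∀ n, x (n + 1) = (1 - α (n + 1)) • x n + α (n + 1) • (T (x n) + e (n + 1))

/-- The sequence `x` converges weakly to `p`. -/
def WeaklyTendsto {X : Type*} [NormedAddCommGroup X] [NormedSpace ℝ X]
    (x : ℕ → X) (p : X) : Prop :=
  Tendsto (fun n => toWeakSpace ℝ X (x n)) atTop (𝓝 (toWeakSpace ℝ X p))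

/-- Opial's property of a normed space. The norms below are bounded, since weakly convergent
sequences are, so both lower limits are the usual ones. -/
def OpialProperty (X : Type*) [NormedAddCommGroup X] [NormedSpace ℝ X] : Prop :=
  ∀ (x : ℕ → X) (p : X), WeaklyTendsto x p → ∀ y : X, y ≠ p →
    liminf (fun n => ‖x n - p‖) atTop < liminf (fun n => ‖x n - y‖) atTop

/-! Distances from `x n` to a fixed point grow by at most `α (n + 1) * ‖e (n + 1)‖` per step, so
they converge. In the compact case a cluster point of `T (x n)` is one of `x n`, hence fixed, and
its distance limit is 0. For a uniformly convex space, the unique minimizer `z` on `C` of the limit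
`r y` of `‖x n - y‖` along an ultrafilter satisfies `r (T z) ≤ r z`, so it is fixed. Under Opial's
property weak cluster points are fixed, and two distinct ones would have distance limits each
strictly below the other. Both minimizers and weak limits come from `exists_mem_of_antitone_convex`.
-/

/-! ### Convergence of distances to fixed points; the compact case. -/

section QuasiFejer

/-- A nonnegative real sequence which increases by at most summable amounts converges. -/
theorem exists_tendsto_of_le_add_summable {a s : ℕ → ℝ} (ha : ∀ n, 0 ≤ a n)
    (hs0 : ∀ n, 0 ≤ s n) (hs : Summable s) (h : ∀ n, a (n + 1) ≤ a n + s n) :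
    ∃ l, Tendsto a atTop (𝓝 l) := by
  have hanti : Antitone fun n => a n - ∑ k ∈ Finset.range n, s k := by
    refine antitone_nat_of_succ_le fun n => ?_
    rw [Finset.sum_range_succ]
    linarith [h n]
  have hbdd : BddBelow (Set.range fun n => a n - ∑ k ∈ Finset.range n, s k) := by
    refine ⟨-∑' k, s k, ?_⟩
    rintro _ ⟨n, rfl⟩
    have := hs.sum_le_tsum (Finset.range n) fun k _ => hs0 k
    simp only
    linarith [ha n]
  refine ⟨_, ((tendsto_atTop_ciInf hanti hbdd).add hs.hasSum.tendsto_sum_nat).congr fun n => ?_⟩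
  ring

theorem IsNonexpansiveOn.continuousOn {X : Type*} [NormedAddCommGroup X] {C : Set X} {T : X → X}
    (hT : IsNonexpansiveOn T C) : ContinuousOn T C := by
  refine (LipschitzOnWith.of_dist_le_mul (K := 1) fun y hy z hz => ?_).continuousOn
  simpa [dist_eq_norm] using hT.2 y hy z hz

variable {X : Type*} [NormedAddCommGroup X] [NormedSpace ℝ X]
  {C : Set X} {T : X → X} {α : ℕ → ℝ} {e x : ℕ → X}

/-- The distances of an inexact Krasnosel'skii-Mann sequence to a fixed point converge. -/
theorem IsInexactKM.exists_tendsto_norm_sub (hx : IsInexactKM T C α e x)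
    (hT : IsNonexpansiveOn T C) (hα : ∀ n, α (n + 1) ∈ Set.Icc (0 : ℝ) 1)
    (hsum : Summable fun k => α (k + 1) * ‖e (k + 1)‖) {p : X} (hp : p ∈ fixSet T C) :
    ∃ l, Tendsto (fun n => ‖x n - p‖) atTop (𝓝 l) := by
  refine exists_tendsto_of_le_add_summable (fun _ => norm_nonneg _)
    (fun n => mul_nonneg (hα n).1 (norm_nonneg _)) hsum fun n => ?_
  obtain ⟨h0, h1⟩ := hα n
  have hTn : ‖T (x n) - p‖ ≤ ‖x n - p‖ := by
    simpa only [hp.2] using hT.2 _ (hx.mem n) p hp.1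
  have heq : x (n + 1) - p = (1 - α (n + 1)) • (x n - p) + α (n + 1) • (T (x n) - p)
      + α (n + 1) • e (n + 1) := by
    rw [hx.step n]
    module
  rw [heq]
  refine (norm_add₃_le).trans ?_
  rw [norm_smul_of_nonneg (sub_nonneg.2 h1), norm_smul_of_nonneg h0, norm_smul_of_nonneg h0]
  nlinarith [mul_le_mul_of_nonneg_left hTn h0]

theorem IsInexactKM.exists_tendsto_of_isCompact (hx : IsInexactKM T C α e x)
    (hC : IsClosed C) (hT : IsNonexpansiveOn T C) (hα : ∀ n, α (n + 1) ∈ Set.Icc (0 : ℝ) 1)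
    (hres : Tendsto (fun n => ‖x n - T (x n)‖) atTop (𝓝 0))
    (hsum : Summable fun k => α (k + 1) * ‖e (k + 1)‖) (hcpt : IsCompact (closure (T '' C))) :
    ∃ p ∈ fixSet T C, Tendsto x atTop (𝓝 p) := by
  obtain ⟨p, -, φ, hφ, hTp⟩ := hcpt.tendsto_subseq
    fun n => subset_closure (Set.mem_image_of_mem T (hx.mem n))
  have hxp : Tendsto (fun n => x (φ n)) atTop (𝓝 p) := by
    have h0 := (tendsto_zero_iff_norm_tendsto_zero.2 hres).comp hφ.tendsto_atTop
    simpa using h0.add hTp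
  have hpC : p ∈ C := hC.mem_of_tendsto hxp (Eventually.of_forall fun n => hx.mem _)
  have hTp' : Tendsto (fun n => T (x (φ n))) atTop (𝓝 (T p)) :=
    (hT.continuousOn p hpC).tendsto.comp
      (tendsto_nhdsWithin_iff.2 ⟨hxp, Eventually.of_forall fun n => hx.mem _⟩)
  have hp : p ∈ fixSet T C := ⟨hpC, tendsto_nhds_unique hTp' hTp⟩
  obtain ⟨l, hl⟩ := hx.exists_tendsto_norm_sub hT hα hsum hp
  have hl0 : l = 0 :=
    tendsto_nhds_unique (hl.comp hφ.tendsto_atTop) (tendsto_iff_norm_sub_tendsto_zero.1 hxp)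
  exact ⟨p, hp, tendsto_iff_norm_sub_tendsto_zero.2 (hl0 ▸ hl)⟩

end QuasiFejer

/-! ### Consequences of uniform convexity: nested sets, asymptotic centers, weak compactness. -/

section UniformConvex

variable {X : Type*} [NormedAddCommGroup X] [NormedSpace ℝ X]

/-- Two points of a ball slightly larger than that of radius `r` that are not close to each other
have their midpoint in a ball slightly smaller than that of radius `r`. -/
theorem exists_pos_forall_norm_add_le [UniformConvexSpace X] {ε : ℝ} (hε : 0 < ε) {r : ℝ}
    (hr : 0 ≤ r) :
    ∃ δ, 0 < δ ∧ ∀ u v : X, ‖u‖ ≤ r + δ → ‖v‖ ≤ r + δ → ε ≤ ‖u - v‖ →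
      ‖u + v‖ ≤ 2 * (r - δ) := by
  obtain ⟨η, hη, H⟩ := exists_forall_closed_ball_dist_add_le_two_mul_sub X (half_pos hε) r
  -- Scaling into the `r`-ball moves each point by at most `δ`: separation stays at least `ε - 2 * δ
  -- ≥ ε / 2`, and `2 * r - η + 2 * δ ≤ 2 * (r - δ)`.
  have hδ : 0 < min (ε / 4) (η / 4) := lt_min (by linarith) (by linarith)
  have hδε : min (ε / 4) (η / 4) ≤ ε / 4 := min_le_left _ _
  have hδη : min (ε / 4) (η / 4) ≤ η / 4 := min_le_right _ _
  refine ⟨_, hδ, ?_⟩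
  generalize min (ε / 4) (η / 4) = δ at hδ hδε hδη
  have hpos : 0 < r + δ := by linarith
  have shrink : ∀ w : X, ‖w‖ ≤ r + δ →
      ‖(r / (r + δ)) • w‖ ≤ r ∧ ‖w - (r / (r + δ)) • w‖ ≤ δ := by
    intro w hw
    constructor
    · rw [norm_smul_of_nonneg (by positivity), div_mul_eq_mul_div, div_le_iff₀ hpos]
      gcongr
    · have : w - (r / (r + δ)) • w = (δ / (r + δ)) • w := by
        have h1 : δ / (r + δ) = 1 - r / (r + δ) := by field_simp; ring
        rw [h1, sub_smul, one_smul]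
      rw [this, norm_smul_of_nonneg (by positivity), div_mul_eq_mul_div, div_le_iff₀ hpos]
      gcongr
  intro u v hu hv huv
  obtain ⟨hu1, hu2⟩ := shrink u hu
  obtain ⟨hv1, hv2⟩ := shrink v hv
  generalize (r / (r + δ)) • u = u' at hu1 hu2
  generalize (r / (r + δ)) • v = v' at hv1 hv2
  have h1 : ‖u - v‖ ≤ ‖u' - v'‖ + ‖u - u'‖ + ‖v - v'‖ := by
    rw [norm_sub_rev v v', show u - v = (u' - v') + (u - u') + (v' - v) by abel]
    exact norm_add₃_le
  have h2 : ‖u + v‖ ≤ ‖u' + v'‖ + ‖u - u'‖ + ‖v - v'‖ := by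
    rw [show u + v = (u' + v') + (u - u') + (v - v') by abel]
    exact norm_add₃_le
  have h3 := H hu1 hv1 (by linarith)
  linarith

/-- In a uniformly convex Banach space, a directed family of nonempty bounded closed convex sets
has a common point. -/
theorem exists_mem_of_antitone_convex [CompleteSpace X] [UniformConvexSpace X] {ι : Type*}
    [SemilatticeSup ι] [Nonempty ι] {K : ι → Set X} (hanti : Antitone K)
    (hne : ∀ i, (K i).Nonempty) (hcl : ∀ i, IsClosed (K i)) (hconv : ∀ i, Convex ℝ (K i))
    {R : ℝ} (hR : ∀ i, ∀ y ∈ K i, ‖y‖ ≤ R) : ∃ z, ∀ i, z ∈ K i := by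
  have hbdd : BddAbove (Set.range fun i => Metric.infDist 0 (K i)) := by
    refine ⟨R, ?_⟩
    rintro _ ⟨i, rfl⟩
    obtain ⟨y, hy⟩ := hne i
    exact (Metric.infDist_le_dist_of_mem hy).trans (by simpa using hR i y hy)
  set d := ⨆ i, Metric.infDist 0 (K i)
  have hd : 0 ≤ d := Real.iSup_nonneg fun _ => Metric.infDist_nonneg
  have hex : ∀ (i : ι) (n : ℕ), ∃ u ∈ K i, ‖u‖ < d + 1 / ((n : ℝ) + 1) := by
    intro i n
    have hlt : Metric.infDist 0 (K i) < d + 1 / ((n : ℝ) + 1) :=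
      (le_ciSup hbdd i).trans_lt (lt_add_of_pos_right _ Nat.one_div_pos_of_nat)
    simpa using (Metric.infDist_lt_iff (hne i)).1 hlt
  choose u huK hu using hex
  have hcauchy : CauchySeq fun q : ι × ℕ => u q.1 q.2 := by
    refine Metric.cauchySeq_iff'.2 fun ε hε => ?_
    obtain ⟨δ, hδ, H⟩ := exists_pos_forall_norm_add_le (X := X) hε hd
    -- Beyond `(i, n)`, two far-apart near-minimal points would have a midpoint in `K i` of norm at
    -- most `d - δ`, less than the distance from 0 to `K i`.
    obtain ⟨i, hi⟩ := exists_lt_of_lt_ciSup (sub_lt_self d hδ)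
    obtain ⟨n, hn⟩ := exists_nat_one_div_lt hδ
    refine ⟨(i, n), fun q hq => ?_⟩
    by_contra! hcon
    rw [dist_eq_norm] at hcon
    have hq2 : 1 / ((q.2 : ℝ) + 1) ≤ 1 / ((n : ℝ) + 1) := Nat.one_div_le_one_div hq.2
    have h1 := H _ _ (by linarith [hu q.1 q.2]) (by linarith [hu i n]) hcon
    have hmem : (1 / 2 : ℝ) • u q.1 q.2 + (1 / 2 : ℝ) • u i n ∈ K i :=
      hconv i (hanti hq.1 (huK _ _)) (huK _ _) (by norm_num) (by norm_num) (by norm_num)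
    have h2 := Metric.infDist_le_dist_of_mem (x := 0) hmem
    rw [dist_zero_left, ← smul_add, norm_smul_of_nonneg (by norm_num)] at h2
    linarith
  obtain ⟨z, hz⟩ := cauchySeq_tendsto_of_complete hcauchy
  refine ⟨z, fun i => (hcl i).mem_of_tendsto hz ?_⟩
  filter_upwards [eventually_ge_atTop (i, 0)] with q hq using hanti hq.1 (huK _ _)

/-- An ultrafilter gives limits for all bounded families at once, with no subsequence extraction. -/
theorem Ultrafilter.exists_tendsto_real {ι : Type*} (U : Ultrafilter ι) {f : ι → ℝ} {M : ℝ}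
    (hf : ∀ i, |f i| ≤ M) : ∃ l, Tendsto f U (𝓝 l) := by
  obtain ⟨l, -, hl⟩ := (isCompact_Icc (a := -M) (b := M)).ultrafilter_le_nhds (U.map f)
    (le_principal_iff.2 (Ultrafilter.mem_map.2 (univ_mem' fun i => abs_le.1 (hf i))))
  exact ⟨l, hl⟩

/-- In a uniformly convex Banach space, if the distances to a family converge to `r` along a filter,
then `r` has a unique minimizer on any nonempty closed convex set, the asymptotic center. -/
theorem exists_asymptotic_center [CompleteSpace X] [UniformConvexSpace X] {ι : Type*}
    {l : Filter ι} [l.NeBot] {C : Set X} (hne : C.Nonempty) (hcl : IsClosed C)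
    (hconv : Convex ℝ C) {x : ι → X} {r : X → ℝ}
    (hr : ∀ y, Tendsto (fun i => ‖x i - y‖) l (𝓝 (r y))) :
    ∃ z ∈ C, ∀ y ∈ C, r y ≤ r z → y = z := by
  have hr0 : ∀ y, 0 ≤ r y := fun y => ge_of_tendsto' (hr y) fun _ => norm_nonneg _
  have hlip : LipschitzWith 1 r := by
    refine LipschitzWith.of_le_add fun y z => le_of_tendsto_of_tendsto' (hr y)
      ((hr z).add_const _) fun i => ?_
    rw [dist_comm, dist_eq_norm]
    exact norm_sub_le_norm_sub_add_norm_sub _ _ _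
  have hrconv : ConvexOn ℝ C r := by
    refine ⟨hconv, fun y _ z _ a b ha hb hab => le_of_tendsto_of_tendsto' (hr _)
      (((hr y).const_mul a).add ((hr z).const_mul b)) fun i => ?_⟩
    have : x i - (a • y + b • z) = a • (x i - y) + b • (x i - z) := by
      rw [smul_sub, smul_sub, sub_add_sub_comm, ← add_smul, hab, one_smul]
    rw [this, ← norm_smul_of_nonneg ha, ← norm_smul_of_nonneg hb]
    exact norm_add_le _ _
  -- This bounds the sublevel sets of `r`; those at heights decreasing to the infimum are nested,
  -- and a common point is a minimizer.
  have hbound : ∀ y, ‖y‖ ≤ r 0 + r y := fun y =>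
    ge_of_tendsto' ((hr 0).add (hr y)) fun i => by
      rw [sub_zero]
      simpa using norm_sub_le (x i) (x i - y)
  have hbdd : BddBelow (r '' C) := ⟨0, by rintro _ ⟨y, -, rfl⟩; exact hr0 y⟩
  obtain ⟨z, hz⟩ := exists_mem_of_antitone_convex (X := X)
    (K := fun n : ℕ => {y | y ∈ C ∧ r y ≤ sInf (r '' C) + 1 / ((n : ℝ) + 1)})
    (fun m n hmn y hy => ⟨hy.1, hy.2.trans (by gcongr)⟩)
    (fun n => by
      obtain ⟨_, ⟨y, hy, rfl⟩, hlt⟩ := exists_lt_of_csInf_lt (hne.image r)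
        (lt_add_of_pos_right (sInf (r '' C)) (Nat.one_div_pos_of_nat (n := n)))
      exact ⟨y, hy, hlt.le⟩)
    (fun n => hcl.inter (isClosed_le hlip.continuous continuous_const))
    (fun n => hrconv.convex_le _)
    (R := r 0 + (sInf (r '' C) + 1))
    (fun n y hy => (hbound y).trans (by
      have : 1 / ((n : ℝ) + 1) ≤ 1 := by
        rw [div_le_one (by positivity)]
        linarith [n.cast_nonneg (α := ℝ)]
      linarith [hy.2]))
  have hzC : z ∈ C := (hz 0).1
  have hmin : ∀ y ∈ C, r z ≤ r y := fun y hy =>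
    (ge_of_tendsto' (by simpa using
      (tendsto_one_div_add_atTop_nhds_zero_nat (𝕜 := ℝ)).const_add (sInf (r '' C)))
      fun n => (hz n).2).trans (csInf_le hbdd ⟨y, hy, rfl⟩)
  refine ⟨z, hzC, fun y hy hyz => ?_⟩
  by_contra hne
  obtain ⟨δ, hδ, H⟩ := exists_pos_forall_norm_add_le (X := X)
    (norm_pos_iff.2 (sub_ne_zero.2 hne)) (hr0 z)
  have hmem : (1 / 2 : ℝ) • y + (1 / 2 : ℝ) • z ∈ C :=
    hconv hy hzC (by norm_num) (by norm_num) (by norm_num)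
  have hle : r ((1 / 2 : ℝ) • y + (1 / 2 : ℝ) • z) ≤ r z - δ := by
    refine le_of_tendsto (hr _) ?_
    filter_upwards [(hr y).eventually_lt_const (lt_of_le_of_lt hyz (lt_add_of_pos_right _ hδ)),
      (hr z).eventually_lt_const (lt_add_of_pos_right _ hδ)] with i h1 h2
    have h3 := H (x i - z) (x i - y) h2.le h1.le (by rw [sub_sub_sub_cancel_left])
    have : x i - ((1 / 2 : ℝ) • y + (1 / 2 : ℝ) • z)
        = (1 / 2 : ℝ) • ((x i - z) + (x i - y)) := by module
    rw [this, norm_smul_of_nonneg (by norm_num)]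
    linarith
  linarith [hmin _ hmem]

/-- A nonexpansive map with a bounded approximate fixed point sequence has a fixed point. -/
theorem IsNonexpansiveOn.fixSet_nonempty [CompleteSpace X] [UniformConvexSpace X] {C : Set X}
    {T : X → X} (hT : IsNonexpansiveOn T C) (hcl : IsClosed C) (hconv : Convex ℝ C) {x : ℕ → X}
    (hxC : ∀ n, x n ∈ C) (hbdd : Bornology.IsBounded (Set.range x))
    (hres : Tendsto (fun n => ‖x n - T (x n)‖) atTop (𝓝 0)) : (fixSet T C).Nonempty := by
  obtain ⟨M, hM⟩ := hbdd.exists_norm_le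
  have hex : ∀ y, ∃ l, Tendsto (fun n => ‖x n - y‖) (hyperfilter ℕ) (𝓝 l) := fun y =>
    (hyperfilter ℕ).exists_tendsto_real (M := M + ‖y‖) fun n => by
      rw [abs_norm]
      exact (norm_sub_le _ _).trans (by gcongr; exact hM _ ⟨n, rfl⟩)
  choose r hr using hex
  obtain ⟨z, hzC, hz⟩ := exists_asymptotic_center ⟨x 0, hxC 0⟩ hcl hconv hr
  refine ⟨z, hzC, hz _ (hT.1 hzC) ?_⟩
  have h0 := (hres.mono_left Nat.hyperfilter_le_atTop).add (hr z)
  rw [zero_add] at h0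
  refine le_of_tendsto_of_tendsto' (hr (T z)) h0 fun n => ?_
  exact (norm_sub_le_norm_sub_add_norm_sub _ (T (x n)) _).trans
    (add_le_add_right (hT.2 _ (hxC n) _ hzC) _)

theorem tendsto_toWeakSpace_iff {ι : Type*} {l : Filter ι} {x : ι → X} {p : X} :
    Tendsto (fun i => toWeakSpace ℝ X (x i)) l (𝓝 (toWeakSpace ℝ X p)) ↔
      ∀ f : StrongDual ℝ X, Tendsto (fun i => f (x i)) l (𝓝 (f p)) := by
  have hind : IsInducing fun (y : WeakSpace ℝ X) (f : StrongDual ℝ X) =>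
      f ((toWeakSpace ℝ X).symm y) := ⟨rfl⟩
  rw [hind.tendsto_nhds_iff, tendsto_pi_nhds]
  rfl

/-- Bounded sets in a uniformly convex Banach space are relatively weakly compact. -/
theorem Ultrafilter.exists_tendsto_toWeakSpace [CompleteSpace X] [UniformConvexSpace X]
    {ι : Type*} (U : Ultrafilter ι) {x : ι → X} {M : ℝ} (hM : ∀ i, ‖x i‖ ≤ M) :
    ∃ z ∈ closedConvexHull ℝ (Set.range x),
      Tendsto (fun i => toWeakSpace ℝ X (x i)) U (𝓝 (toWeakSpace ℝ X z)) := by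
  -- The members of `U` under reverse inclusion index the closed convex hulls of the tails; a common
  -- point is the weak limit.
  let _ : SemilatticeInf {A : Set ι // A ∈ U} := Subtype.semilatticeInf fun _ _ => inter_mem
  have : Nonempty ({A : Set ι // A ∈ U})ᵒᵈ := ⟨OrderDual.toDual ⟨Set.univ, univ_mem⟩⟩
  obtain ⟨z, hz⟩ := exists_mem_of_antitone_convex (X := X)
    (ι := ({A : Set ι // A ∈ U})ᵒᵈ)
    (K := fun A => closedConvexHull ℝ (x '' (OrderDual.ofDual A).1))
    (fun A B hAB => (closedConvexHull ℝ).monotone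
      (Set.image_mono (show (OrderDual.ofDual B).1 ⊆ (OrderDual.ofDual A).1 from hAB)))
    (fun A => ((U.nonempty_of_mem (OrderDual.ofDual A).2).image x).mono
      subset_closedConvexHull)
    (fun A => isClosed_closedConvexHull) (fun A => convex_closedConvexHull)
    (R := M) (fun A y hy => by
      have : closedConvexHull ℝ (x '' (OrderDual.ofDual A).1) ⊆ Metric.closedBall 0 M :=
        closedConvexHull_min (by rintro _ ⟨i, -, rfl⟩; simpa using hM i)
          (convex_closedBall _ _) Metric.isClosed_closedBall
      simpa using this hy)
  refine ⟨z, (closedConvexHull ℝ).monotone (Set.image_subset_range _ _)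
    (hz (OrderDual.toDual ⟨Set.univ, univ_mem⟩)), tendsto_toWeakSpace_iff.2 fun f => ?_⟩
  obtain ⟨c, hc⟩ := U.exists_tendsto_real (f := fun i => f (x i)) (M := ‖f‖ * M) fun i =>
    (f.le_opNorm _).trans (by gcongr; exact hM i)
  suffices h : f z = c by rwa [h]
  refine eq_of_forall_dist_le fun ε hε => ?_
  have hA : {i | f (x i) ∈ Metric.closedBall c ε} ∈ U :=
    hc (Metric.closedBall_mem_nhds c hε)
  have hsub : closedConvexHull ℝ (x '' {i | f (x i) ∈ Metric.closedBall c ε}) ⊆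
      f ⁻¹' Metric.closedBall c ε :=
    closedConvexHull_min (by rintro _ ⟨i, hi, rfl⟩; exact hi)
      ((convex_closedBall c ε).linear_preimage f.toLinearMap)
      (Metric.isClosed_closedBall.preimage f.continuous)
  exact hsub (hz (OrderDual.toDual ⟨_, hA⟩))

/-- A separable set has a countable family of functionals separating its points from zero. -/
theorem exists_seq_strongDual_separating {s : Set X} (hs : TopologicalSpace.IsSeparable s) :
    ∃ f : ℕ → StrongDual ℝ X, (∀ n, ‖f n‖ ≤ 1) ∧ ∀ y ∈ s, (∀ n, f n y = 0) → y = 0 := by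
  obtain ⟨D, hD, hsD⟩ := hs
  -- Inserting 0 makes the countable set nonempty, hence the range of a sequence.
  obtain ⟨u, hu⟩ := (hD.insert 0).exists_eq_range (Set.insert_nonempty _ _)
  choose f hf1 hf using fun n => exists_dual_vector'' ℝ (u n)
  refine ⟨f, hf1, fun y hy h0 => ?_⟩
  refine norm_le_zero_iff.1 (le_of_forall_pos_le_add fun ε hε => ?_)
  obtain ⟨w, hw, hyw⟩ := Metric.mem_closure_iff.1 (hsD hy) (ε / 2) (half_pos hε)
  obtain ⟨n, rfl⟩ : w ∈ Set.range u := hu ▸ Set.mem_insert_of_mem _ hw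
  rw [dist_eq_norm] at hyw
  have h1 : ‖u n‖ ≤ ‖y - u n‖ := by
    have h2 : f n (u n - y) = ‖u n‖ := by simp [h0 n, hf n]
    calc ‖u n‖ = f n (u n - y) := h2.symm
      _ ≤ ‖f n (u n - y)‖ := le_abs_self _
      _ ≤ 1 * ‖u n - y‖ := (f n).le_of_opNorm_le (hf1 n) _
      _ = ‖y - u n‖ := by rw [one_mul, norm_sub_rev]
  have h3 : ‖y‖ ≤ ‖y - u n‖ + ‖u n‖ := by simpa using norm_add_le (y - u n) (u n)
  linarith

/-- Bounded sequences in a uniformly convex Banach space have weakly convergent subsequences. -/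
theorem exists_weaklyTendsto_subseq [CompleteSpace X] [UniformConvexSpace X] {x : ℕ → X}
    (hbdd : Bornology.IsBounded (Set.range x)) :
    ∃ z ∈ closedConvexHull ℝ (Set.range x), ∃ φ : ℕ → ℕ, StrictMono φ ∧
      WeaklyTendsto (fun n => x (φ n)) z := by
  obtain ⟨M, hM⟩ := hbdd.exists_norm_le
  replace hM : ∀ n, ‖x n‖ ≤ M := fun n => hM _ ⟨n, rfl⟩
  set Y : Submodule ℝ X := (Submodule.span ℝ (Set.range x)).topologicalClosure
  have hY : closedConvexHull ℝ (Set.range x) ⊆ Y :=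
    closedConvexHull_min (Submodule.subset_span.trans (Submodule.le_topologicalClosure _))
      Y.convex (Submodule.isClosed_topologicalClosure _)
  have hYsep : TopologicalSpace.IsSeparable (Y : Set X) := by
    rw [Submodule.topologicalClosure_coe]
    exact ((Set.countable_range x).isSeparable.span (R := ℝ)).closure
  obtain ⟨f, hf1, hf⟩ := exists_seq_strongDual_separating hYsep
  -- Compactness of a countable product replaces the diagonal argument: every `f k` converges along
  -- `φ`. Weak limits along different ultrafilters then share the values `c k`, so they coincide.
  obtain ⟨c, -, φ, hφ, hc⟩ :=
    (isCompact_univ_pi fun _ : ℕ => isCompact_Icc (a := -M) (b := M)).tendsto_subseq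
      (x := fun n k => f k (x n)) fun n k _ => abs_le.1 <|
        ((f k).le_of_opNorm_le (hf1 k) _).trans (by rw [one_mul]; exact hM n)
  rw [tendsto_pi_nhds] at hc
  have key : ∀ U : Ultrafilter ℕ, (U : Filter ℕ) ≤ atTop →
      ∃ z ∈ closedConvexHull ℝ (Set.range x), (∀ k, f k z = c k) ∧
        Tendsto (fun n => toWeakSpace ℝ X (x (φ n))) U (𝓝 (toWeakSpace ℝ X z)) := by
    intro U hU
    obtain ⟨z, hz, hzU⟩ := U.exists_tendsto_toWeakSpace (x := fun n => x (φ n)) fun n => hM _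
    exact ⟨z, (closedConvexHull ℝ).monotone (Set.range_comp_subset_range φ x) hz,
      fun k => tendsto_nhds_unique (tendsto_toWeakSpace_iff.1 hzU (f k)) ((hc k).mono_left hU),
      hzU⟩
  obtain ⟨z, hz, hzc, -⟩ := key (hyperfilter ℕ) Nat.hyperfilter_le_atTop
  refine ⟨z, hz, φ, hφ, (tendsto_iff_ultrafilter _ _ _).2 fun U hU => ?_⟩
  obtain ⟨w, hw, hwc, hwU⟩ := key U hU
  have : w - z = 0 := hf _ (Y.sub_mem (hY hw) (hY hz)) fun k => by
    rw [map_sub, hzc, hwc, sub_self]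
  rwa [sub_eq_zero.1 this] at hwU

end UniformConvex

/-! ### Opial's property: demiclosedness and weak convergence. -/

section Opial

variable {X : Type*} [NormedAddCommGroup X] [NormedSpace ℝ X]

theorem WeaklyTendsto.comp_tendsto {x : ℕ → X} {p : X} (h : WeaklyTendsto x p) {φ : ℕ → ℕ}
    (hφ : Tendsto φ atTop atTop) : WeaklyTendsto (fun n => x (φ n)) p :=
  Tendsto.comp (g := fun n => toWeakSpace ℝ X (x n)) h hφ

theorem OpialProperty.lt_of_tendsto (hO : OpialProperty X) {x : ℕ → X} {p y : X}
    (hx : WeaklyTendsto x p) (hy : y ≠ p) {a b : ℝ}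
    (ha : Tendsto (fun n => ‖x n - p‖) atTop (𝓝 a))
    (hb : Tendsto (fun n => ‖x n - y‖) atTop (𝓝 b)) : a < b := by
  simpa only [ha.liminf_eq, hb.liminf_eq] using hO x p hx y hy

/-- Demiclosedness principle in spaces with Opial's property. -/
theorem OpialProperty.map_eq_of_weaklyTendsto (hO : OpialProperty X) {C : Set X} {T : X → X}
    (hT : IsNonexpansiveOn T C) {x : ℕ → X} (hxC : ∀ n, x n ∈ C)
    (hbdd : Bornology.IsBounded (Set.range x))
    (hres : Tendsto (fun n => ‖x n - T (x n)‖) atTop (𝓝 0)) {q : X} (hq : q ∈ C)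
    (hxq : WeaklyTendsto x q) : T q = q := by
  obtain ⟨M, hM⟩ := hbdd.exists_norm_le
  have hle : ∀ n y, ‖x n - y‖ ∈ Set.Icc 0 (M + ‖y‖) := fun n y =>
    ⟨norm_nonneg _, (norm_sub_le _ _).trans (by gcongr; exact hM _ ⟨n, rfl⟩)⟩
  -- Both distances converge along one subsequence, so the lower limits in Opial's property become
  -- limits.
  obtain ⟨⟨a, b⟩, -, φ, hφ, hab⟩ :=
    (isCompact_Icc.prod isCompact_Icc).tendsto_subseq
      (x := fun n => (‖x n - q‖, ‖x n - T q‖)) fun n => ⟨hle n q, hle n (T q)⟩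
  have ha : Tendsto (fun n => ‖x (φ n) - q‖) atTop (𝓝 a) := hab.fst_nhds
  have hb : Tendsto (fun n => ‖x (φ n) - T q‖) atTop (𝓝 b) := hab.snd_nhds
  by_contra hne
  refine (hO.lt_of_tendsto (hxq.comp_tendsto hφ.tendsto_atTop) hne ha hb).not_ge ?_
  have h0 := (hres.comp hφ.tendsto_atTop).add ha
  rw [zero_add] at h0
  refine le_of_tendsto_of_tendsto' hb h0 fun n => ?_
  exact (norm_sub_le_norm_sub_add_norm_sub _ (T (x (φ n))) _).trans
    (add_le_add_right (hT.2 _ (hxC _) _ hq) _)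

theorem IsInexactKM.exists_weaklyTendsto [CompleteSpace X] [UniformConvexSpace X]
    {C : Set X} {T : X → X} {α : ℕ → ℝ} {e x : ℕ → X} (hx : IsInexactKM T C α e x)
    (hcl : IsClosed C) (hconv : Convex ℝ C) (hT : IsNonexpansiveOn T C)
    (hα : ∀ n, α (n + 1) ∈ Set.Icc (0 : ℝ) 1)
    (hres : Tendsto (fun n => ‖x n - T (x n)‖) atTop (𝓝 0))
    (hsum : Summable fun k => α (k + 1) * ‖e (k + 1)‖)
    (hbdd : Bornology.IsBounded (Set.range x)) (hO : OpialProperty X) :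
    ∃ p ∈ fixSet T C, WeaklyTendsto x p := by
  -- Stated for every `ns` because weak convergence of `x` is tested by refining arbitrary
  -- subsequences.
  have key : ∀ ns : ℕ → ℕ, Tendsto ns atTop atTop → ∃ q ∈ fixSet T C, ∃ ms : ℕ → ℕ,
      Tendsto (fun n => ns (ms n)) atTop atTop ∧ WeaklyTendsto (fun n => x (ns (ms n))) q := by
    intro ns hns
    obtain ⟨q, hq, φ, hφ, hφq⟩ := exists_weaklyTendsto_subseq
      (hbdd.subset (Set.range_comp_subset_range ns x))
    have hqC : q ∈ C :=
      closedConvexHull_min (Set.range_subset_iff.2 fun n => hx.mem (ns n)) hconv hcl hq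
    have hlim := hns.comp hφ.tendsto_atTop
    exact ⟨q, ⟨hqC, hO.map_eq_of_weaklyTendsto hT (fun n => hx.mem _)
      (hbdd.subset (Set.range_comp_subset_range (ns ∘ φ) x)) (hres.comp hlim) hqC hφq⟩,
      φ, hlim, hφq⟩
  obtain ⟨p, hp, φ, hφ, hφp⟩ := key id tendsto_id
  refine ⟨p, hp, tendsto_of_subseq_tendsto fun ns hns => ?_⟩
  obtain ⟨q, hq, ms, hms, hmsq⟩ := key ns hns
  obtain ⟨a, ha⟩ := hx.exists_tendsto_norm_sub hT hα hsum hp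
  obtain ⟨b, hb⟩ := hx.exists_tendsto_norm_sub hT hα hsum hq
  suffices h : q = p by
    subst h
    exact ⟨ms, hmsq⟩
  by_contra hne
  exact lt_asymm (hO.lt_of_tendsto hφp hne (ha.comp hφ) (hb.comp hφ))
    (hO.lt_of_tendsto hmsq (Ne.symm hne) (hb.comp hms) (ha.comp hms))

end Opial

theorem mainTheorem4 {X : Type*} [NormedAddCommGroup X] [NormedSpace ℝ X] [CompleteSpace X]
    (C : Set X) (hCclosed : IsClosed C) (hCconvex : Convex ℝ C)
    (T : X → X) (hT : IsNonexpansiveOn T C)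
    (α : ℕ → ℝ) (hα : ∀ n, α (n + 1) ∈ Set.Icc (0 : ℝ) 1)
    (e : ℕ → X) (x : ℕ → X) (hx : IsInexactKM T C α e x)
    (hres : Tendsto (fun n => ‖x n - T (x n)‖) atTop (𝓝 0))
    (hsum : Summable (fun k => α (k + 1) * ‖e (k + 1)‖)) :
    (IsCompact (closure (T '' C)) →
      ∃ p ∈ fixSet T C, Tendsto x atTop (𝓝 p)) ∧
    (UniformConvexSpace X → Bornology.IsBounded (Set.range x) →
      (fixSet T C).Nonempty ∧
      (OpialProperty X → ∃ p ∈ fixSet T C, WeaklyTendsto x p)) := by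
  refine ⟨hx.exists_tendsto_of_isCompact hCclosed hT hα hres hsum, fun hX hbdd => ⟨?_, fun hO => ?_⟩⟩
  · exact hT.fixSet_nonempty hCclosed hCconvex hx.mem hbdd hres
  · exact hx.exists_weaklyTendsto hCclosed hCconvex hT hα hres hsum hbdd hO
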